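/- **Theorem 4.11 ($4\times4$ Lemma).** Let $(\mathcal C,\mathbb E,\mathfrak s)$ be an extriangulated category in the sense of Nakaoka and Palu. Write $X\xrightarrow{f}Y\xrightarrow{g}Z\overset{\delta}{\dashrightarrow}$ for an $\mathbb E$-triangle, i.e. $\delta\in\mathbb E(Z,X)$ is realized by $X\xrightarrow{f}Y\xrightarrow{g}Z$; then $f$ is called an $\mathbb E$-inflation and $g$ an $\mathbb E$-deflation. A morphism from this $\mathbb E$-triangle to an $\mathbb E$-triangle $X'\xrightarrow{f'}Y'\xrightarrow{g'}Z'\overset{\delta'}{\dashrightarrow}$ is a triple $(\alpha,\beta,\gamma)$ with $\beta f=f'\alpha$, $\gamma g=g'\beta$ and $\alpha_*\delta=\gamma^*\delta'$. It is *homotopic* if there are an $\mathbb E$-triangle $X'\xrightarrow{s}E\xrightarrow{t}Z\overset{\eta}{\dashrightarrow}$ and a factorization $\beta=\beta_2\beta_1$ with $\beta_1:Y\to E$, $\beta_2:E\to Y'$ such that $(\alpha,\beta_1,1_Z)$ and $(1_{X'},\beta_2,\gamma)$ are morphisms of $\mathbb E$-triangles (from the first to the middle and from the middle to the last) and $$X\xrightarrow{\binom{f}{\alpha}}Y\oplus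 X'\xrightarrow{(\beta_1,\,-s)}E\overset{t^*\delta}{\dashrightarrow},\qquad E\xrightarrow{\binom{-t}{\beta_2}}Z\oplus Y'\xrightarrow{(\gamma,\,g')}Z'\overset{s_*\delta'}{\dashrightarrow}$$ are $\mathbb E$-triangles. Let $\mathcal L$ be the full subcategory of objects $K$ such that $K\to0$ is an $\mathbb E$-inflation, and $\mathcal R$ that of objects $R$ such that $0\to R$ is an $\mathbb E$-deflation. For every $K\in\mathcal L$ fix an $\mathbb E$-triangle $K\to0\to FK\overset{\delta_K}{\dashrightarrow}$. Then $F$ is a functor $\mathcal L\to\mathcal R$, where for $h:K\to K'$ in $\mathcal L$, $Fh$ is the unique morphism with $h_*\delta_K=(Fh)^*\delta_{K'}$. For $K\in\mathcal L$ and $A\in\mathcal C$ let $\ell:\mathbb E(A,K)\to\mathcal C(A,FK)$ and $\rho:\mathbb E(FK,A)\to\mathcal C(K,A)$ be the isomorphisms with $\ell^{-1}(\varphi)=\varphi^*\delta_K$ and $\rho^{-1}(\psi)=\psi_*\delta_K$. Let $X\xrightarrow{f}Y\xrightarrow{g}Z\overset{\delta}{\dashrightarrow}$ and $L\xrightarrow{u}M\xrightarrow{v}N\overset{\varepsilon}{\dashrightarrow}$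 be $\mathbb E$-triangles, and let $\alpha:X\to L$ and $\gamma:Z\to N$ be morphisms such that $\alpha_*\delta=\gamma^*\varepsilon$ and each of $\alpha$, $\gamma$ is both an $\mathbb E$-inflation and an $\mathbb E$-deflation. Then there is a morphism $\beta:Y\to M$ that is both an $\mathbb E$-inflation and an $\mathbb E$-deflation such that $(\alpha,\beta,\gamma)$ is a homotopic morphism of $\mathbb E$-triangles. Moreover, for this $\beta$ there are objects $K_\alpha,K_\beta,K_\gamma\in\mathcal L$ and, with $C_\alpha=FK_\alpha$, $C_\beta=FK_\beta$, $C_\gamma=FK_\gamma$, a commutative diagram $$\begin{array}{ccccc} K_\alpha&\xrightarrow{f'}&K_\beta&\xrightarrow{g'}&K_\gamma\\ {\scriptstyle i_\alpha}\downarrow&&{\scriptstyle i_\beta}\downarrow&&{\scriptstyle i_\gamma}\downarrow\\ X&\xrightarrow{f}&Y&\xrightarrow{g}&Z\\ {\scriptstyle\alpha}\downarrow&&{\scriptstyle\beta}\downarrow&&{\scriptstyle\gamma}\downarrow\\ L&\xrightarrow{u}&M&\xrightarrow{v}&N\\ {\scriptstyle p_\alpha}\downarrow&&{\scriptstyle p_\beta}\downarrow&&{\scriptstyle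 p_\gamma}\downarrow\\ C_\alpha&\xrightarrow{u'}&C_\beta&\xrightarrow{v'}&C_\gamma \end{array}$$ with $u'=Ff'$ and $v'=Fg'$, and a morphism $z:K_\gamma\to C_\alpha$, such that the following are $\mathbb E$-triangles: 1. $K_\alpha\xrightarrow{f'}K_\beta\xrightarrow{g'}K_\gamma$ with extension $\ell^{-1}(z)$; 2. $K_\beta\xrightarrow{g'}K_\gamma\xrightarrow{z}C_\alpha$ with extension $-\ell^{-1}(u')$; 3. $K_\gamma\xrightarrow{z}C_\alpha\xrightarrow{u'}C_\beta$ with extension $\rho^{-1}(g')$; 4. $C_\alpha\xrightarrow{u'}C_\beta\xrightarrow{v'}C_\gamma$ with extension $-\rho^{-1}(z)$; 5. $K_\alpha\xrightarrow{i_\alpha}X\xrightarrow{\alpha}L$ with extension $\ell^{-1}(p_\alpha)$; 6. $K_\beta\xrightarrow{i_\beta}Y\xrightarrow{\beta}M$ with extension $\ell^{-1}(p_\beta)$; 7. $K_\gamma\xrightarrow{i_\gamma}Z\xrightarrow{\gamma}N$ with extension $\ell^{-1}(p_\gamma)$; 8. $X\xrightarrow{\alpha}L\xrightarrow{p_\alpha}C_\alpha$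 with extension $-\rho^{-1}(i_\alpha)$; 9. $Y\xrightarrow{\beta}M\xrightarrow{p_\beta}C_\beta$ with extension $-\rho^{-1}(i_\beta)$; 10. $Z\xrightarrow{\gamma}N\xrightarrow{p_\gamma}C_\gamma$ with extension $-\rho^{-1}(i_\gamma)$; and such that $(i_\alpha,i_\beta,i_\gamma)$, $(p_\alpha,p_\beta,p_\gamma)$, $(f',f,u)$, $(f,u,u')$, $(g',g,v)$ and $(g,v,v')$ are morphisms between the corresponding $\mathbb E$-triangles (rows, respectively columns, of the diagram). In particular, in the sequence $$K_\alpha\xrightarrow{f'}K_\beta\xrightarrow{g'}K_\gamma\xrightarrow{z}C_\alpha\xrightarrow{u'}C_\beta\xrightarrow{v'}C_\gamma$$ any three consecutive terms form an $\mathbb E$-triangle as in 1–4. -/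

import Mathlib

open CategoryTheory CategoryTheory.Limits Opposite

open scoped ZeroObject

universe w v u

namespace Extri

section Extensions

variable {C : Type u} [Category.{v} C]

/-- The type `𝔼(Z, X)` of `𝔼`-extensions (contravariant in `Z`, covariant in `X`). -/
abbrev Ext (E : Cᵒᵖ ⥤ C ⥤ AddCommGrpCat.{w}) (Z X : C) : Type w :=
  (E.obj (op Z)).obj X

/-- The map `a_* : 𝔼(Z, X) → 𝔼(Z, X')` induced by `a : X ⟶ X'`. -/
def push (E : Cᵒᵖ ⥤ C ⥤ AddCommGrpCat.{w}) {X X' Z : C} (a : X ⟶ X') :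
    Ext E Z X →+ Ext E Z X' :=
  ((E.obj (op Z)).map a).hom

/-- The map `c^* : 𝔼(Z, X) → 𝔼(Z', X)` induced by `c : Z' ⟶ Z`. -/
def pull (E : Cᵒᵖ ⥤ C ⥤ AddCommGrpCat.{w}) {X Z Z' : C} (c : Z' ⟶ Z) :
    Ext E Z X →+ Ext E Z' X :=
  ((E.map c.op).app X).hom

/-- The direct sum `δ ⊕ δ' ∈ 𝔼(Z ⊕ Z', X ⊕ X')`: the image of `(δ, δ')` under the inclusion of
`𝔼(Z, X) ⊕ 𝔼(Z', X')` in `𝔼(Z ⊕ Z', X ⊕ X')`. -/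
noncomputable def extSum [Preadditive C] [HasBinaryBiproducts C]
    (E : Cᵒᵖ ⥤ C ⥤ AddCommGrpCat.{w}) {X Z X' Z' : C} (δ : Ext E Z X) (δ' : Ext E Z' X') :
    Ext E (Z ⊞ Z') (X ⊞ X') :=
  push E (biprod.inl : X ⟶ X ⊞ X') (pull E (biprod.fst : Z ⊞ Z' ⟶ Z) δ) +
    push E (biprod.inr : X' ⟶ X ⊞ X') (pull E (biprod.snd : Z ⊞ Z' ⟶ Z') δ')

/-- Sequences `X ⟶ Y ⟶ Z` with fixed end terms. -/
structure Seq (X Z : C) where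
  mid : C
  f : X ⟶ mid
  g : mid ⟶ Z

/-- Equivalence of sequences: an isomorphism of the middle terms that is compatible with
the identities of the end terms. -/
def seqSetoid (X Z : C) : Setoid (Seq X Z) where
  r S T := ∃ φ : S.mid ≅ T.mid, S.f ≫ φ.hom = T.f ∧ φ.hom ≫ T.g = S.g
  iseqv :=
    { refl := fun S => ⟨Iso.refl _, by simp, by simp⟩
      symm := by
        rintro S T ⟨φ, h1, h2⟩
        exact ⟨φ.symm, by simp [← h1], by simp [← h2]⟩
      trans := by
        rintro S T U ⟨φ, h1, h2⟩ ⟨ψ, h3, h4⟩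
        exact ⟨φ ≪≫ ψ, by simp [← h3, ← h1], by simp [← h2, ← h4]⟩ }

/-- Equivalence classes of sequences `X ⟶ Y ⟶ Z`. -/
abbrev SeqClass (X Z : C) := Quotient (seqSetoid X Z)

/-- The class `[X ⟶ Y ⟶ Z]`. -/
def seqClass {X Y Z : C} (f : X ⟶ Y) (g : Y ⟶ Z) : SeqClass X Z :=
  Quotient.mk (seqSetoid X Z) ⟨Y, f, g⟩

end Extensions

/-- An extriangulated category `(C, 𝔼, 𝔰)` on an additive category `C`
(additive: preadditive, with a zero object and binary biproducts). -/
structure ExtriangulatedCategory (C : Type u) [Category.{v} C] [Preadditive C]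
    [HasZeroObject C] [HasBinaryBiproducts C] where
  /-- ET1: the bifunctor `𝔼`, additive in each variable. -/
  E : Cᵒᵖ ⥤ C ⥤ AddCommGrpCat.{w}
  additive_left : ∀ X : C, (E.flip.obj X).Additive
  additive_right : ∀ Z : Cᵒᵖ, (E.obj Z).Additive
  /-- ET2: the additive realization `𝔰`. -/
  real : ∀ {X Z : C}, Ext E Z X → SeqClass X Z
  real_hom : ∀ {X Y Z X' Y' Z' : C} (f : X ⟶ Y) (g : Y ⟶ Z) (δ : Ext E Z X)
    (f' : X' ⟶ Y') (g' : Y' ⟶ Z') (δ' : Ext E Z' X') (α : X ⟶ X') (γ : Z ⟶ Z'),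
    real δ = seqClass f g → real δ' = seqClass f' g' → push E α δ = pull E γ δ' →
    ∃ β : Y ⟶ Y', f ≫ β = α ≫ f' ∧ β ≫ g' = g ≫ γ
  real_zero : ∀ X Z : C,
    real (0 : Ext E Z X) = seqClass (biprod.inl : X ⟶ X ⊞ Z) (biprod.snd : X ⊞ Z ⟶ Z)
  real_sum : ∀ {X Y Z X' Y' Z' : C} (f : X ⟶ Y) (g : Y ⟶ Z) (δ : Ext E Z X)
    (f' : X' ⟶ Y') (g' : Y' ⟶ Z') (δ' : Ext E Z' X'),
    real δ = seqClass f g → real δ' = seqClass f' g' →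
    real (extSum E δ δ') = seqClass (biprod.map f f') (biprod.map g g')
  et3 : ∀ {X Y Z X' Y' Z' : C} (f : X ⟶ Y) (g : Y ⟶ Z) (δ : Ext E Z X)
    (f' : X' ⟶ Y') (g' : Y' ⟶ Z') (δ' : Ext E Z' X') (α : X ⟶ X') (β : Y ⟶ Y'),
    real δ = seqClass f g → real δ' = seqClass f' g' → f ≫ β = α ≫ f' →
    ∃ γ : Z ⟶ Z', β ≫ g' = g ≫ γ ∧ push E α δ = pull E γ δ'
  et3_op : ∀ {X Y Z X' Y' Z' : C} (f : X ⟶ Y) (g : Y ⟶ Z) (δ : Ext E Z X)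
    (f' : X' ⟶ Y') (g' : Y' ⟶ Z') (δ' : Ext E Z' X') (β : Y ⟶ Y') (γ : Z ⟶ Z'),
    real δ = seqClass f g → real δ' = seqClass f' g' → β ≫ g' = g ≫ γ →
    ∃ α : X ⟶ X', f ≫ β = α ≫ f' ∧ push E α δ = pull E γ δ'
  et4 : ∀ {A B D M N : C} (f : A ⟶ B) (g : B ⟶ D) (δ : Ext E D A)
    (b : B ⟶ M) (c : M ⟶ N) (ε : Ext E N B),
    real δ = seqClass f g → real ε = seqClass b c →
    ∃ (P : C) (m : A ⟶ M) (h : M ⟶ P) (d : D ⟶ P) (q : P ⟶ N) (θ : Ext E P A)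
      (η : Ext E N D),
      real θ = seqClass m h ∧ real η = seqClass d q ∧
      f ≫ b = m ∧ b ≫ h = g ≫ d ∧ h ≫ q = c ∧
      pull E d θ = δ ∧ push E g ε = η ∧ push E f θ = pull E q ε
  et4_op : ∀ {A M P D N : C} (m : A ⟶ M) (h : M ⟶ P) (θ : Ext E P A)
    (d : D ⟶ P) (q : P ⟶ N) (η : Ext E N D),
    real θ = seqClass m h → real η = seqClass d q →
    ∃ (B : C) (f : A ⟶ B) (g : B ⟶ D) (b : B ⟶ M) (c : M ⟶ N) (δ : Ext E D A)
      (ε : Ext E N B),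
      real δ = seqClass f g ∧ real ε = seqClass b c ∧
      f ≫ b = m ∧ b ≫ h = g ≫ d ∧ h ≫ q = c ∧
      pull E d θ = δ ∧ push E g ε = η ∧ push E f θ = pull E q ε

namespace ExtriangulatedCategory

variable {C : Type u} [Category.{v} C] [Preadditive C] [HasZeroObject C] [HasBinaryBiproducts C]
  (T : ExtriangulatedCategory.{w} C)

/-- `X ⟶ Y ⟶ Z` with `δ` is an `𝔼`-triangle: `δ` is realized by `X ⟶ Y ⟶ Z`. -/
def IsTriangle {X Y Z : C} (f : X ⟶ Y) (g : Y ⟶ Z) (δ : Ext T.E Z X) : Prop :=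
  T.real δ = seqClass f g

/-- `f` is an `𝔼`-inflation. -/
def IsInflation {X Y : C} (f : X ⟶ Y) : Prop :=
  ∃ (Z : C) (g : Y ⟶ Z) (δ : Ext T.E Z X), T.IsTriangle f g δ

/-- `g` is an `𝔼`-deflation. -/
def IsDeflation {Y Z : C} (g : Y ⟶ Z) : Prop :=
  ∃ (X : C) (f : X ⟶ Y) (δ : Ext T.E Z X), T.IsTriangle f g δ

/-- `(α, β, γ)` is a morphism from the `𝔼`-triangle `(f, g, δ)` to the `𝔼`-triangle
`(f', g', δ')`. -/
structure IsMorphism {X Y Z X' Y' Z' : C} (f : X ⟶ Y) (g : Y ⟶ Z) (δ : Ext T.E Z X)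
    (f' : X' ⟶ Y') (g' : Y' ⟶ Z') (δ' : Ext T.E Z' X')
    (α : X ⟶ X') (β : Y ⟶ Y') (γ : Z ⟶ Z') : Prop where
  source : T.IsTriangle f g δ
  target : T.IsTriangle f' g' δ'
  comm₁ : f ≫ β = α ≫ f'
  comm₂ : g ≫ γ = β ≫ g'
  ext : push T.E α δ = pull T.E γ δ'

/-- The morphism `(α, β, γ)` of `𝔼`-triangles is homotopic. -/
structure IsHomotopic {X Y Z X' Y' Z' : C} (f : X ⟶ Y) (g : Y ⟶ Z) (δ : Ext T.E Z X)
    (f' : X' ⟶ Y') (g' : Y' ⟶ Z') (δ' : Ext T.E Z' X')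
    (α : X ⟶ X') (β : Y ⟶ Y') (γ : Z ⟶ Z') : Prop where
  isMorphism : T.IsMorphism f g δ f' g' δ' α β γ
  exists_factorization : ∃ (W : C) (s : X' ⟶ W) (t : W ⟶ Z) (η : Ext T.E Z X')
    (β₁ : Y ⟶ W) (β₂ : W ⟶ Y'),
    T.IsMorphism f g δ s t η α β₁ (𝟙 Z) ∧
    T.IsMorphism s t η f' g' δ' (𝟙 X') β₂ γ ∧
    β₁ ≫ β₂ = β ∧
    T.IsTriangle (biprod.lift f α) (biprod.desc β₁ (-s)) (pull T.E t δ) ∧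
    T.IsTriangle (biprod.lift (-t) β₂) (biprod.desc γ g') (push T.E s δ')

/-- The class `ℒ` of objects `X` such that `X ⟶ 0` is an `𝔼`-inflation. -/
def L : ObjectProperty C := fun X => T.IsInflation (0 : X ⟶ (0 : C))

/-- The class `ℛ` of objects `X` such that `0 ⟶ X` is an `𝔼`-deflation. -/
def R : ObjectProperty C := fun X => T.IsDeflation (0 : (0 : C) ⟶ X)

/-- A choice of an `𝔼`-triangle `X ⟶ 0 ⟶ FX` with extension `δ_X`, for each `X ∈ ℒ`. -/
structure ShiftChoice where
  obj : T.L.FullSubcategory → C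
  ext : ∀ X : T.L.FullSubcategory, Ext T.E (obj X) X.obj
  isTriangle : ∀ X : T.L.FullSubcategory,
    T.IsTriangle (0 : X.obj ⟶ (0 : C)) (0 : (0 : C) ⟶ obj X) (ext X)

section Calculus

lemma push_id {X Z : C} (δ : Ext T.E Z X) : push T.E (𝟙 X) δ = δ := by
  simp [push]

lemma pull_id {X Z : C} (δ : Ext T.E Z X) : pull T.E (𝟙 Z) δ = δ := by
  simp [pull]

lemma push_comp {X X' X'' Z : C} (a : X ⟶ X') (b : X' ⟶ X'') (δ : Ext T.E Z X) :
    push T.E (a ≫ b) δ = push T.E b (push T.E a δ) := by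
  simp [push]

lemma pull_comp {X Z Z' Z'' : C} (a : Z'' ⟶ Z') (b : Z' ⟶ Z) (δ : Ext T.E Z X) :
    pull T.E (a ≫ b) δ = pull T.E a (pull T.E b δ) := by
  simp [pull]

lemma push_pull {X X' Z Z' : C} (a : X ⟶ X') (c : Z' ⟶ Z) (δ : Ext T.E Z X) :
    push T.E a (pull T.E c δ) = pull T.E c (push T.E a δ) := by
  have h := (T.E.map c.op).naturality a
  exact (ConcreteCategory.congr_hom h δ).symm

lemma push_add {X X' Z : C} (a b : X ⟶ X') (δ : Ext T.E Z X) :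
    push T.E (a + b) δ = push T.E a δ + push T.E b δ := by
  have := T.additive_right (op Z)
  simp [push, Functor.map_add]

lemma pull_add {X Z Z' : C} (a b : Z' ⟶ Z) (δ : Ext T.E Z X) :
    pull T.E (a + b) δ = pull T.E a δ + pull T.E b δ := by
  have := T.additive_left X
  have h : (T.E.flip.obj X).map (a.op + b.op) = _ := Functor.map_add _
  exact ConcreteCategory.congr_hom h δ

end Calculus

namespace ShiftChoice

variable {T}
variable (F : T.ShiftChoice)

/-- The homomorphism `C(M, FX) → 𝔼(M, X)`, `φ ↦ φ^* δ_X`. -/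
def pullHom (M : C) (X : T.L.FullSubcategory) : (M ⟶ F.obj X) →+ Ext T.E M X.obj :=
  AddMonoidHom.mk' (fun φ => pull T.E φ (F.ext X)) (fun a b => T.pull_add a b _)

/-- The homomorphism `C(X, M) → 𝔼(FX, M)`, `ψ ↦ ψ_* δ_X`. -/
def pushHom (X : T.L.FullSubcategory) (M : C) : (X.obj ⟶ M) →+ Ext T.E (F.obj X) M :=
  AddMonoidHom.mk' (fun ψ => push T.E ψ (F.ext X)) (fun a b => T.push_add a b _)

lemma pullHom_bijective (M : C) (X : T.L.FullSubcategory) :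
    Function.Bijective (F.pullHom M X) := by
  constructor
  · rw [injective_iff_map_eq_zero]
    intro φ (hφ : pull T.E φ (F.ext X) = 0)
    obtain ⟨β, -, h⟩ := T.real_hom _ _ _ _ _ _ (𝟙 X.obj) φ (T.real_zero X.obj M)
      (F.isTriangle X) (by rw [hφ, map_zero])
    rw [comp_zero] at h
    rw [← cancel_epi (biprod.snd : X.obj ⊞ M ⟶ M), ← h, comp_zero]
  · intro η
    obtain ⟨⟨Y, f, g⟩, hS⟩ := Quotient.exists_rep (T.real η)
    obtain ⟨γ, -, h⟩ := T.et3 f g η _ _ _ (𝟙 X.obj) 0 hS.symm (F.isTriangle X) (by simp)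
    exact ⟨γ, by rw [← T.push_id η, h]; rfl⟩

lemma pushHom_bijective (X : T.L.FullSubcategory) (M : C) :
    Function.Bijective (F.pushHom X M) := by
  constructor
  · rw [injective_iff_map_eq_zero]
    intro ψ (hψ : push T.E ψ (F.ext X) = 0)
    obtain ⟨β, h, -⟩ := T.real_hom _ _ _ _ _ _ ψ (𝟙 (F.obj X)) (F.isTriangle X)
      (T.real_zero M (F.obj X)) (by rw [hψ, map_zero])
    rw [zero_comp] at h
    rw [← cancel_mono (biprod.inl : M ⟶ M ⊞ F.obj X), ← h, zero_comp]
  · intro η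
    obtain ⟨⟨Y, f, g⟩, hS⟩ := Quotient.exists_rep (T.real η)
    obtain ⟨α, -, h⟩ := T.et3_op _ _ _ f g η 0 (𝟙 (F.obj X)) (F.isTriangle X) hS.symm (by simp)
    exact ⟨α, by rw [← T.pull_id η, ← h]; rfl⟩

/-- The isomorphism `ℓ : 𝔼(M, X) ≃ C(M, FX)`, inverse to `φ ↦ φ^* δ_X`. -/
noncomputable def ell (M : C) (X : T.L.FullSubcategory) : Ext T.E M X.obj ≃+ (M ⟶ F.obj X) :=
  (AddEquiv.ofBijective (F.pullHom M X) (F.pullHom_bijective M X)).symm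

/-- The isomorphism `ρ : 𝔼(FX, M) ≃ C(X, M)`, inverse to `ψ ↦ ψ_* δ_X`. -/
noncomputable def rho (X : T.L.FullSubcategory) (M : C) : Ext T.E (F.obj X) M ≃+ (X.obj ⟶ M) :=
  (AddEquiv.ofBijective (F.pushHom X M) (F.pushHom_bijective X M)).symm

/-- For `f : X ⟶ Y` in `ℒ` there is a unique `h : FX ⟶ FY` with `f_* δ_X = h^* δ_Y`. -/
lemma existsUnique_map {X Y : T.L.FullSubcategory} (f : X ⟶ Y) :
    ∃! h : F.obj X ⟶ F.obj Y, push T.E f.hom (F.ext X) = pull T.E h (F.ext Y) := by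
  obtain ⟨h, hh⟩ := (F.pullHom_bijective (F.obj X) Y).2 (push T.E f.hom (F.ext X))
  exact ⟨h, hh.symm, fun h' hh' =>
    (F.pullHom_bijective (F.obj X) Y).1 (hh'.symm.trans hh.symm)⟩

/-- The morphism `Ff`, the unique one with `f_* δ_X = (Ff)^* δ_Y`. -/
noncomputable def map {X Y : T.L.FullSubcategory} (f : X ⟶ Y) : F.obj X ⟶ F.obj Y :=
  (F.existsUnique_map f).choose

lemma map_spec {X Y : T.L.FullSubcategory} (f : X ⟶ Y) :
    push T.E f.hom (F.ext X) = pull T.E (F.map f) (F.ext Y) :=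
  (F.existsUnique_map f).choose_spec.1

lemma map_unique {X Y : T.L.FullSubcategory} (f : X ⟶ Y) {h : F.obj X ⟶ F.obj Y}
    (hh : push T.E f.hom (F.ext X) = pull T.E h (F.ext Y)) : F.map f = h :=
  (F.existsUnique_map f).unique (F.map_spec f) hh

lemma obj_mem (X : T.L.FullSubcategory) : T.R (F.obj X) :=
  ⟨X.obj, 0, F.ext X, F.isTriangle X⟩

/-- The functor `F : ℒ ⥤ ℛ` between full subcategories of `C`. -/
noncomputable def functor : T.L.FullSubcategory ⥤ T.R.FullSubcategory where
  obj X := ⟨F.obj X, F.obj_mem X⟩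
  map f := ObjectProperty.homMk (F.map f)
  map_id X := by
    ext
    exact F.map_unique _ ((T.push_id _).trans (T.pull_id _).symm)
  map_comp {X Y Z} f g := by
    ext
    refine F.map_unique _ ?_
    change push T.E (f.hom ≫ g.hom) (F.ext X) = pull T.E (F.map f ≫ F.map g) (F.ext Z)
    rw [T.push_comp, F.map_spec f, T.push_pull, F.map_spec g, T.pull_comp]

end ShiftChoice

end ExtriangulatedCategory

end Extri

namespace Extri

/-! Realize `α_*δ = γ^*ε` by a single `L ⟶ W ⟶ Z`. This one row is both the homotopy pushout of `f`
along `α`, giving `β₁ : Y ⟶ W` with cone `FKα`, and the homotopy pullback of `v` along `γ`, giving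
`β₂ : W ⟶ M` with cocone `Kγ`. So `β = β₁ ≫ β₂` is homotopic by construction.

Objects of `ℒ` behave as in a triangulated category: a triangle starting at `K ∈ ℒ` can be rotated,
because its homotopy pushout square against `K ⟶ 0 ⟶ FK` has a zero corner (`isTriangle_rotate`,
`isTriangle_rotate_inv`). Hence `β₁` also has cocone `Kα`, and `β₂` is also an inflation. The dual
of ET4, applied to the deflations `β₁` and `β₂`, yields `Kα ⟶ Kβ ⟶ Kγ` and the middle column. Since
`β` is an inflation as well, `Kβ ∈ ℒ` by `IsTriangle.mem_L`. Rotation then produces the rest of the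
diagram, and the remaining compatibilities follow from the injectivity of `φ ↦ φ^*δ_K`. -/

lemma isIso_id_add_of_sq_zero {C : Type u} [Category.{v} C] [Preadditive C] {X : C}
    (e : X ⟶ X) (h : e ≫ e = 0) : IsIso (𝟙 X + e) :=
  ⟨𝟙 X - e, by simp [h], by simp [h]⟩

lemma isIso_of_isIso_comp {C : Type u} [Category.{v} C] {X Y : C} (a : X ⟶ Y) (b : Y ⟶ X)
    (h₁ : IsIso (a ≫ b)) (h₂ : IsIso (b ≫ a)) : IsIso a := by
  have : Mono a := mono_of_mono a b
  have : IsSplitEpi a := ⟨⟨⟨inv (b ≫ a) ≫ b, by simp⟩⟩⟩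
  exact isIso_of_mono_of_isSplitEpi a

namespace ExtriangulatedCategory

variable {C : Type u} [Category.{v} C] [Preadditive C] [HasZeroObject C] [HasBinaryBiproducts C]
  {T : ExtriangulatedCategory.{w} C}

lemma exists_isTriangle (T : ExtriangulatedCategory.{w} C) {X Z : C} (δ : Ext T.E Z X) :
    ∃ (Y : C) (f : X ⟶ Y) (g : Y ⟶ Z), T.IsTriangle f g δ := by
  obtain ⟨⟨Y, f, g⟩, h⟩ := Quotient.exists_rep (T.real δ)
  exact ⟨Y, f, g, h.symm⟩

/-! ### Consequences of the biadditivity of `𝔼`. -/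

lemma push_zero (T : ExtriangulatedCategory.{w} C) {X X' Z : C} (δ : Ext T.E Z X) :
    push T.E (0 : X ⟶ X') δ = 0 := by
  have h' := T.push_add (0 : X ⟶ X') 0 δ
  rw [add_zero] at h'
  exact left_eq_add.mp h'

lemma push_neg (T : ExtriangulatedCategory.{w} C) {X X' Z : C} (a : X ⟶ X') (δ : Ext T.E Z X) :
    push T.E (-a) δ = -push T.E a δ := by
  rw [eq_neg_iff_add_eq_zero, ← T.push_add, neg_add_cancel, T.push_zero]

lemma pull_zero (T : ExtriangulatedCategory.{w} C) {X Z Z' : C} (δ : Ext T.E Z X) :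
    pull T.E (0 : Z' ⟶ Z) δ = 0 := by
  have h' := T.pull_add (0 : Z' ⟶ Z) 0 δ
  rw [add_zero] at h'
  exact left_eq_add.mp h'

lemma pull_neg (T : ExtriangulatedCategory.{w} C) {X Z Z' : C} (a : Z' ⟶ Z) (δ : Ext T.E Z X) :
    pull T.E (-a) δ = -pull T.E a δ := by
  rw [eq_neg_iff_add_eq_zero, ← T.pull_add, neg_add_cancel, T.pull_zero]

lemma isTriangle_split (T : ExtriangulatedCategory.{w} C) (X Z : C) :
    T.IsTriangle (biprod.inl : X ⟶ X ⊞ Z) (biprod.snd : X ⊞ Z ⟶ Z) 0 :=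
  T.real_zero X Z

/-! ### Exactness properties of a triangle. -/

namespace IsTriangle

section

variable {X Y Z : C} {f : X ⟶ Y} {g : Y ⟶ Z} {δ : Ext T.E Z X}

/-- As with the other exactness statements of this section, the proof compares the triangle with a
split one, here `X = X ⟶ 0`. -/
lemma comp_eq_zero (h : T.IsTriangle f g δ) : f ≫ g = 0 := by
  obtain ⟨c, hc, -⟩ := T.et3 _ _ _ f g δ (𝟙 X) (biprod.fst ≫ f) (T.isTriangle_split X 0) h
    (by simp)
  have := biprod.inl (X := X) (Y := (0 : C)) ≫= hc
  simpa using this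

lemma exists_fac_left (h : T.IsTriangle f g δ) {W : C} (ψ : W ⟶ Y) (hψ : ψ ≫ g = 0) :
    ∃ χ : W ⟶ X, χ ≫ f = ψ := by
  obtain ⟨a, ha, -⟩ := T.et3_op _ _ _ f g δ (biprod.fst ≫ ψ) 0 (T.isTriangle_split W 0) h
    (by simp [hψ])
  exact ⟨a, by simpa using ha.symm⟩

lemma exists_fac_right (h : T.IsTriangle f g δ) {W : C} (ψ : Y ⟶ W) (hψ : f ≫ ψ = 0) :
    ∃ χ : Z ⟶ W, g ≫ χ = ψ := by
  obtain ⟨a, ha, -⟩ := T.et3 f g δ _ _ _ 0 (ψ ≫ biprod.inr) h (T.isTriangle_split 0 W)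
    (by simp [reassoc_of% hψ])
  exact ⟨a, by simpa using ha.symm⟩

/-- The map `(f, 1) : X ⊞ Y ⟶ Y` lies over `g`, so `g^*δ` is a pushforward of the split extension.
-/
lemma pull_eq_zero (h : T.IsTriangle f g δ) : pull T.E g δ = 0 := by
  obtain ⟨a, -, ha⟩ := T.et3_op _ _ _ f g δ (biprod.desc f (𝟙 Y)) g (T.isTriangle_split X Y) h
    (by ext <;> simp [h.comp_eq_zero])
  rw [← ha, map_zero]

lemma push_eq_zero (h : T.IsTriangle f g δ) : push T.E f δ = 0 := by
  obtain ⟨a, -, ha⟩ := T.et3 f g δ _ _ _ f (biprod.lift (𝟙 Y) g) h (T.isTriangle_split Y Z)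
    (by ext <;> simp [h.comp_eq_zero])
  rw [ha, map_zero]

lemma exists_lift (h : T.IsTriangle f g δ) {W : C} (φ : W ⟶ Z) (hφ : pull T.E φ δ = 0) :
    ∃ ψ : W ⟶ Y, ψ ≫ g = φ := by
  obtain ⟨b, -, hb⟩ := T.real_hom _ _ _ f g δ (𝟙 X) φ (T.isTriangle_split X W) h
    (by rw [hφ, map_zero])
  exact ⟨biprod.inr ≫ b, by simp [hb]⟩

lemma exists_desc (h : T.IsTriangle f g δ) {W : C} (φ : X ⟶ W) (hφ : push T.E φ δ = 0) :
    ∃ ψ : Y ⟶ W, f ≫ ψ = φ := by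
  obtain ⟨b, hb, -⟩ := T.real_hom f g δ _ _ _ φ (𝟙 Z) h (T.isTriangle_split W Z)
    (by rw [hφ, map_zero])
  exact ⟨b ≫ biprod.fst, by simp [reassoc_of% hb]⟩

lemma exists_iso (h : T.IsTriangle f g δ) {Y' : C} {f' : X ⟶ Y'} {g' : Y' ⟶ Z}
    (h' : T.IsTriangle f' g' δ) : ∃ φ : Y ≅ Y', f ≫ φ.hom = f' ∧ φ.hom ≫ g' = g :=
  Quotient.exact (Eq.trans (Eq.symm h) h')

lemma of_iso_mid (h : T.IsTriangle f g δ) {Y' : C} {f' : X ⟶ Y'} {g' : Y' ⟶ Z}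
    (φ : Y ≅ Y') (h₁ : f ≫ φ.hom = f') (h₂ : φ.hom ≫ g' = g) : T.IsTriangle f' g' δ :=
  Eq.trans h (Quotient.sound (s := seqSetoid X Z) ⟨φ, h₁, h₂⟩)

end

/-! ### Isomorphisms of triangles and uniqueness of cones and cocones. -/

section

variable {X Y Z X' Y' Z' : C} {f : X ⟶ Y} {g : Y ⟶ Z} {δ : Ext T.E Z X}
  {f' : X' ⟶ Y'} {g' : Y' ⟶ Z'} {δ' : Ext T.E Z' X'}

/-- The difference `b - 𝟙` factors through `g` and is killed by `g`, so it squares to zero. The next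
two lemmas use the same argument at the end terms; it takes the place of the five lemma. -/
lemma isIso_mid_self (h : T.IsTriangle f g δ) (b : Y ⟶ Y) (h₁ : f ≫ b = f) (h₂ : b ≫ g = g) :
    IsIso b := by
  obtain ⟨k, hk⟩ := h.exists_fac_right (b - 𝟙 Y) (by simp [h₁])
  have : b = 𝟙 Y + (b - 𝟙 Y) := by simp
  rw [this]
  refine isIso_id_add_of_sq_zero _ ?_
  nth_rewrite 2 [← hk]
  rw [← Category.assoc, Preadditive.sub_comp, h₂]
  simp

lemma isIso_right_self (h : T.IsTriangle f g δ) (c : Z ⟶ Z) (h₁ : g ≫ c = g)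
    (h₂ : pull T.E c δ = δ) : IsIso c := by
  obtain ⟨k, hk⟩ := h.exists_lift (c - 𝟙 Z)
    (by rw [sub_eq_add_neg, T.pull_add, T.pull_neg, h₂, T.pull_id, add_neg_cancel])
  have : c = 𝟙 Z + (c - 𝟙 Z) := by simp
  rw [this]
  refine isIso_id_add_of_sq_zero _ ?_
  nth_rewrite 1 [← hk]
  simp [h₁]

lemma isIso_left_self (h : T.IsTriangle f g δ) (a : X ⟶ X) (h₁ : a ≫ f = f)
    (h₂ : push T.E a δ = δ) : IsIso a := by
  obtain ⟨k, hk⟩ := h.exists_desc (a - 𝟙 X)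
    (by rw [sub_eq_add_neg, T.push_add, T.push_neg, h₂, T.push_id, add_neg_cancel])
  have : a = 𝟙 X + (a - 𝟙 X) := by simp
  rw [this]
  refine isIso_id_add_of_sq_zero _ ?_
  nth_rewrite 2 [← hk]
  rw [← Category.assoc, Preadditive.sub_comp, h₁]
  simp

/-- Morphisms of extensions that are invertible at both ends lift to isomorphisms of triangles. -/
lemma exists_iso_mid (h : T.IsTriangle f g δ) (h' : T.IsTriangle f' g' δ') (a : X ≅ X')
    (c : Z ≅ Z') (e : push T.E a.hom δ = pull T.E c.hom δ') :
    ∃ b : Y ≅ Y', f ≫ b.hom = a.hom ≫ f' ∧ b.hom ≫ g' = g ≫ c.hom := by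
  have e' : push T.E a.inv δ' = pull T.E c.inv δ := by
    rw [← T.push_id δ, ← a.hom_inv_id, T.push_comp, e, ← T.push_pull, ← T.pull_comp,
      c.inv_hom_id, T.pull_id]
  obtain ⟨b, hb₁, hb₂⟩ := T.real_hom _ _ _ _ _ _ _ _ h h' e
  obtain ⟨b', hb₁', hb₂'⟩ := T.real_hom _ _ _ _ _ _ _ _ h' h e'
  have : IsIso b := isIso_of_isIso_comp b b'
    (h.isIso_mid_self _ (by rw [reassoc_of% hb₁, hb₁', a.hom_inv_id_assoc])
      (by rw [Category.assoc, hb₂', reassoc_of% hb₂, c.hom_inv_id, Category.comp_id]))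
    (h'.isIso_mid_self _ (by rw [reassoc_of% hb₁', hb₁, a.inv_hom_id_assoc])
      (by rw [Category.assoc, hb₂, reassoc_of% hb₂', c.inv_hom_id, Category.comp_id]))
  exact ⟨asIso b, hb₁, hb₂⟩

/-- Any realization of `δ'` is isomorphic to `(f, g)` by a map over `a` and `c`; composing its
inverse with `b` gives an equivalence with `(f', g')`. -/
lemma of_iso (h : T.IsTriangle f g δ) (a : X ≅ X') (b : Y ≅ Y') (c : Z ≅ Z')
    (h₁ : f ≫ b.hom = a.hom ≫ f') (h₂ : b.hom ≫ g' = g ≫ c.hom)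
    (e : push T.E a.hom δ = pull T.E c.hom δ') : T.IsTriangle f' g' δ' := by
  obtain ⟨Y₁, f₁, g₁, h'⟩ := T.exists_isTriangle δ'
  obtain ⟨b₀, hb₁, hb₂⟩ := h.exists_iso_mid h' a c e
  refine h'.of_iso_mid (b₀.symm ≪≫ b) ?_ ?_
  · rw [← cancel_epi a.hom]
    simp [← reassoc_of% hb₁, h₁]
  · simp [h₂, ← hb₂]

lemma neg_left (h : T.IsTriangle f g δ) : T.IsTriangle (-f) g (-δ) :=
  h.of_iso ⟨-𝟙 X, -𝟙 X, by simp, by simp⟩ (Iso.refl _) (Iso.refl _) (by simp) (by simp)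
    (by rw [T.push_neg, T.push_id]; exact (T.pull_id _).symm)

lemma neg_right (h : T.IsTriangle f g δ) : T.IsTriangle f (-g) (-δ) :=
  h.of_iso (Iso.refl _) (Iso.refl _) ⟨-𝟙 Z, -𝟙 Z, by simp, by simp⟩ (by simp) (by simp)
    (by rw [T.pull_neg, T.pull_id, neg_neg]; exact T.push_id _)

lemma neg_both (h : T.IsTriangle f g δ) : T.IsTriangle (-f) (-g) δ := by
  simpa using h.neg_left.neg_right

end

section

variable {X Y Z Z' : C} {f : X ⟶ Y} {g : Y ⟶ Z} {δ : Ext T.E Z X} {g' : Y ⟶ Z'}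
  {δ' : Ext T.E Z' X}

/-- The cone of an inflation is unique up to isomorphism. -/
lemma exists_iso_right (h : T.IsTriangle f g δ) (h' : T.IsTriangle f g' δ') :
    ∃ c : Z ≅ Z', g ≫ c.hom = g' ∧ pull T.E c.hom δ' = δ := by
  obtain ⟨c, hc, e⟩ := T.et3 f g δ f g' δ' (𝟙 X) (𝟙 Y) h h' (by simp)
  obtain ⟨c', hc', e'⟩ := T.et3 f g' δ' f g δ (𝟙 X) (𝟙 Y) h' h (by simp)
  rw [T.push_id] at e e'
  rw [Category.id_comp] at hc hc'
  have : IsIso c := isIso_of_isIso_comp c c'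
    (h.isIso_right_self _ (by rw [← reassoc_of% hc, hc']) (by rw [T.pull_comp, ← e', ← e]))
    (h'.isIso_right_self _ (by rw [← reassoc_of% hc', hc]) (by rw [T.pull_comp, ← e, ← e']))
  exact ⟨asIso c, hc.symm, e.symm⟩

end

section

variable {X X' Y Z : C} {f : X ⟶ Y} {g : Y ⟶ Z} {δ : Ext T.E Z X} {f' : X' ⟶ Y}
  {δ' : Ext T.E Z X'}

/-- The cocone of a deflation is unique up to isomorphism. -/
lemma exists_iso_left (h : T.IsTriangle f g δ) (h' : T.IsTriangle f' g δ') :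
    ∃ a : X ≅ X', a.hom ≫ f' = f ∧ push T.E a.hom δ = δ' := by
  obtain ⟨a, ha, e⟩ := T.et3_op f g δ f' g δ' (𝟙 Y) (𝟙 Z) h h' (by simp)
  obtain ⟨a', ha', e'⟩ := T.et3_op f' g δ' f g δ (𝟙 Y) (𝟙 Z) h' h (by simp)
  rw [T.pull_id] at e e'
  rw [Category.comp_id] at ha ha'
  have : IsIso a := isIso_of_isIso_comp a a'
    (h.isIso_left_self _ (by rw [Category.assoc, ← ha', ← ha]) (by rw [T.push_comp, e, e']))
    (h'.isIso_left_self _ (by rw [Category.assoc, ← ha, ← ha']) (by rw [T.push_comp, e', e]))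
  exact ⟨asIso a, ha.symm, e⟩

end

end IsTriangle

/-! ### Split triangles. -/

lemma isTriangle_id_zero (T : ExtriangulatedCategory.{w} C) (X : C) :
    T.IsTriangle (𝟙 X) (0 : X ⟶ (0 : C)) 0 :=
  (T.isTriangle_split X 0).of_iso_mid
    ⟨biprod.fst, biprod.inl, by ext; simp, by simp⟩ (by simp)
    ((isZero_zero C).eq_of_tgt _ _)

lemma isTriangle_zero_id (T : ExtriangulatedCategory.{w} C) (X : C) :
    T.IsTriangle (0 : (0 : C) ⟶ X) (𝟙 X) 0 :=
  (T.isTriangle_split 0 X).of_iso_mid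
    ⟨biprod.snd, biprod.inr, by ext; simp, by simp⟩ (by simp) (by simp)

/-- The standard split triangle, twisted by the involution `(a, b) ↦ (a, x a - b)` of `X ⊞ Y`. The
sign is chosen so that the second map of the homotopy pushout comes out as `(b, -s)`. -/
lemma isTriangle_graph (T : ExtriangulatedCategory.{w} C) {X Y : C} (x : X ⟶ Y) :
    T.IsTriangle (biprod.lift (𝟙 X) x) (biprod.desc x (-𝟙 Y)) 0 :=
  (T.isTriangle_split X Y).of_iso_mid
    ⟨biprod.lift biprod.fst (biprod.fst ≫ x - biprod.snd),
      biprod.lift biprod.fst (biprod.fst ≫ x - biprod.snd), by ext <;> simp, by ext <;> simp⟩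
    (by ext <;> simp) (by ext <;> simp)

lemma isTriangle_cograph (T : ExtriangulatedCategory.{w} C) {X Y : C} (x : X ⟶ Y) :
    T.IsTriangle (biprod.lift (-𝟙 X) x) (biprod.desc x (𝟙 Y)) 0 :=
  (T.isTriangle_split X Y).of_iso_mid
    ⟨biprod.lift (-biprod.fst) (biprod.fst ≫ x + biprod.snd),
      biprod.lift (-biprod.fst) (biprod.fst ≫ x + biprod.snd),
      by ext <;> simp, by ext <;> simp⟩
    (by ext <;> simp) (by ext <;> simp)

/-! ### Homotopy pushouts and pullbacks. -/

namespace IsTriangle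

variable {X Y Z : C} {f : X ⟶ Y} {g : Y ⟶ Z} {δ : Ext T.E Z X}

lemma add_id_left (h : T.IsTriangle f g δ) (W : C) :
    T.IsTriangle (biprod.map f (𝟙 W)) (biprod.fst ≫ g) (push T.E biprod.inl δ) :=
  IsTriangle.of_iso (T.real_sum _ _ _ _ _ _ h (T.isTriangle_id_zero W)) (Iso.refl _)
    (Iso.refl _) ⟨biprod.fst, biprod.inl, by ext; simp, by simp⟩ (by simp) (by simp)
    (by
      refine (T.push_id _).trans ?_
      simp only [extSum, map_zero, add_zero]
      exact T.push_pull _ _ _)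

lemma add_id_right (h : T.IsTriangle f g δ) (W : C) :
    T.IsTriangle (f ≫ biprod.inr) (biprod.map (𝟙 W) g) (pull T.E biprod.snd δ) :=
  IsTriangle.of_iso (T.real_sum _ _ _ _ _ _ (T.isTriangle_zero_id W) h)
    ⟨biprod.snd, biprod.inr, by ext; simp, by simp⟩ (Iso.refl _) (Iso.refl _)
    (by ext <;> simp) (by simp)
    (by
      refine Eq.trans ?_ (T.pull_id _).symm
      simp only [extSum, map_zero, zero_add]
      rw [← T.push_comp, biprod.inr_snd, T.push_id])

/-- The homotopy pushout of an inflation. -/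
lemma exists_homotopy_pushout (h : T.IsTriangle f g δ) {X' : C} (x : X ⟶ X') :
    ∃ (W : C) (s : X' ⟶ W) (t : W ⟶ Z) (b : Y ⟶ W),
      T.IsTriangle s t (push T.E x δ) ∧ f ≫ b = x ≫ s ∧ b ≫ t = g ∧
      T.IsTriangle (biprod.lift f x) (biprod.desc b (-s)) (pull T.E t δ) := by
  -- The inflation `(f, x)` is the graph of `x` followed by `f ⊕ 1`, and ET4 computes its cone.
  obtain ⟨W, m, k, s, t, θ, η, hθ, hη, hm, hk, ht, -, hη', hθ'⟩ :=
    T.et4 _ _ _ _ _ _ (T.isTriangle_graph x) (h.add_id_left X')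
  have h₁ := biprod.inl ≫= hk
  have h₂ := biprod.inr ≫= hk
  have h₃ := biprod.inl ≫= ht
  simp only [biprod.inl_map_assoc, biprod.inl_desc_assoc, biprod.inr_map_assoc, Category.id_comp,
    biprod.inr_desc_assoc, Preadditive.neg_comp, biprod.inl_fst_assoc] at h₁ h₂ h₃
  -- The first component of the ET4 identity between extensions of `P` already determines `θ`.
  have hθ'' : θ = pull T.E t δ := by
    have := congrArg (push T.E biprod.fst) hθ'
    rwa [← T.push_comp, biprod.lift_fst, T.push_id, T.push_pull, ← T.push_comp, biprod.inl_fst,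
      T.push_id] at this
  have hm' : m = biprod.lift f x := by
    rw [← hm]; ext <;> simp
  have hk' : k = biprod.desc (biprod.inl ≫ k) (-s) := by
    ext <;> simp [h₂]
  refine ⟨W, s, t, biprod.inl ≫ k, ?_, h₁, by simpa using h₃, ?_⟩
  · rw [← T.push_comp, biprod.inl_desc] at hη'
    rw [hη']; exact hη
  · rw [← hθ'', ← hm', ← hk']; exact hθ

/-- The homotopy pullback of a deflation. -/
lemma exists_homotopy_pullback (h : T.IsTriangle f g δ) {Z' : C} (x : Z' ⟶ Z) :
    ∃ (W : C) (s : X ⟶ W) (t : W ⟶ Z') (b : W ⟶ Y),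
      T.IsTriangle s t (pull T.E x δ) ∧ s ≫ b = f ∧ b ≫ g = t ≫ x ∧
      T.IsTriangle (biprod.lift (-t) b) (biprod.desc x g) (push T.E s δ) := by
  -- Dually, the deflation `(x, g)` is `1 ⊕ g` followed by the cograph of `x`.
  obtain ⟨W, s, t, k, q, θ, η, hθ, hη, hk, ht, hq, hθ', -, hη'⟩ :=
    T.et4_op _ _ _ _ _ _ (h.add_id_right Z') (T.isTriangle_cograph x)
  have h₁ := hk =≫ biprod.snd
  have h₂ := ht =≫ biprod.fst
  have h₃ := ht =≫ biprod.snd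
  simp only [Category.assoc, biprod.inr_snd, biprod.map_fst, biprod.map_snd, biprod.lift_fst,
    biprod.lift_snd, Preadditive.comp_neg, Category.comp_id] at h₁ h₂ h₃
  have hη'' : η = push T.E s δ := by
    have := congrArg (pull T.E biprod.inr) hη'
    rw [← T.pull_comp, biprod.inr_desc, T.pull_id, ← T.push_pull, ← T.pull_comp, biprod.inr_snd,
      T.pull_id] at this
    exact this.symm
  have hk' : k = biprod.lift (-t) (k ≫ biprod.snd) := by
    ext <;> simp [h₂]
  have hq' : q = biprod.desc x g := by
    rw [← hq]; ext <;> simp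
  refine ⟨W, s, t, k ≫ biprod.snd, ?_, h₁, by simpa using h₃, ?_⟩
  · rw [← T.pull_comp, biprod.lift_snd] at hθ'
    rw [hθ']; exact hθ
  · rw [← hη'', ← hk', ← hq']; exact hη

end IsTriangle

/-! ### Cocones of inflations that are also deflations. -/

/-- An object which is the cocone of a morphism that is both an inflation and a deflation
lies in `ℒ`. -/
lemma IsTriangle.mem_L {K X A : C} {i : K ⟶ X} {a : X ⟶ A} {κ : Ext T.E A K}
    (h : T.IsTriangle i a κ) (ha : T.IsInflation a) : T.L K := by
  obtain ⟨D, p, ι, hp⟩ := ha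
  -- ET4 for `i` followed by `a`: the zero map `K ⟶ A` is an inflation, with cone `P`. The row `A ⟶
  -- P ⟶ D` splits because its extension is `a_*ι = 0`. The aim is to split off from `P` the copy of
  -- `A` embedded by `b`, leaving `K ⟶ 0 ⟶ D`.
  obtain ⟨P, m, b, d, q, θ, η, hθ, hη, hm, hb, hq, -, hη', -⟩ := T.et4 _ _ _ _ _ _ h hp
  replace hη : T.IsTriangle d q 0 := by rwa [← hη', hp.push_eq_zero] at hη
  rw [h.comp_eq_zero] at hm
  subst hm
  obtain ⟨r, hr⟩ := hη.exists_desc (𝟙 A) (map_zero _)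
  obtain ⟨s, hs⟩ := hη.exists_lift (𝟙 D) (map_zero _)
  have hdq := hη.comp_eq_zero
  obtain ⟨x, hx⟩ := hη.exists_fac_left (b - d - p ≫ s) (by simp [hq, hdq, hs])
  have hax : a ≫ x = 0 := by
    have : (a ≫ x) ≫ d = 0 := by
      rw [Category.assoc, hx]
      simp [hb, reassoc_of% hp.comp_eq_zero]
    have := this =≫ r
    simpa [hr] using this
  obtain ⟨e₁, he₁⟩ := hp.exists_fac_right x hax
  have hbe : b = d + p ≫ (e₁ ≫ d + s) := by
    rw [Preadditive.comp_add, reassoc_of% he₁, hx]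
    abel
  -- The maps `b` and `d` agree after `a`, so they differ by a map through `p`; the correction is
  -- arranged to be a section `e` of `q`.
  obtain ⟨e, he, heq⟩ : ∃ e : D ⟶ P, b = d + p ≫ e ∧ e ≫ q = 𝟙 D :=
    ⟨_, hbe, by simp [hdq, hs]⟩
  have hdec : (r - q ≫ e ≫ r) ≫ d + q ≫ e = 𝟙 P := by
    obtain ⟨y, hy⟩ := hη.exists_fac_left (𝟙 P - q ≫ e) (by simp [heq])
    have hy' : y = r - q ≫ e ≫ r := by
      have := hy =≫ r
      simpa [hr] using this
    rw [← hy', hy, sub_add_cancel]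
  generalize hr' : r - q ≫ e ≫ r = r' at hdec
  have hdr : d ≫ r' = 𝟙 A := by simp [← hr', hr, reassoc_of% hdq]
  have her : e ≫ r' = 0 := by simp [← hr', reassoc_of% heq]
  -- Thus `b` and `e` also decompose `P` as `A ⊞ D`, with projections `r'` and `π`.
  obtain ⟨π, hbπ, heπ, hπ⟩ : ∃ π : P ⟶ D, b ≫ π = 0 ∧ e ≫ π = 𝟙 D ∧ r' ≫ b + π ≫ e = 𝟙 P := by
    refine ⟨q - r' ≫ p, ?_, ?_, ?_⟩
    · have hbr : b ≫ r' = 𝟙 A := by simp [he, hdr, her]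
      rw [Preadditive.comp_sub, hq, reassoc_of% hbr, sub_self]
    · simp [heq, reassoc_of% her]
    · rw [he, ← hdec, Preadditive.comp_add, Preadditive.sub_comp, Category.assoc]
      abel
  -- Since `b^*θ = 0`, the extension `θ` is concentrated on the summand `D`.
  have hθπ : θ = pull T.E π (pull T.E e θ) := by
    conv_lhs => rw [← T.pull_id θ, ← hπ, T.pull_add, T.pull_comp, T.pull_comp]
    rw [IsTriangle.pull_eq_zero hθ, map_zero, zero_add]
  obtain ⟨W, k, y, hW⟩ := T.exists_isTriangle (pull T.E e θ)
  obtain ⟨β, hβ₁, hβ₂⟩ := T.real_hom _ _ _ _ _ _ (𝟙 K) π hθ hW (by rw [T.push_id, ← hθπ])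
  obtain ⟨β', -, hβ'⟩ := T.real_hom _ _ _ _ _ _ (𝟙 K) e hW hθ (T.push_id _)
  have hk : k = 0 := by simpa using hβ₁.symm
  have hy : y = 0 := by
    rw [← Category.comp_id y, ← heπ, ← Category.assoc, ← hβ', Category.assoc, hbπ, comp_zero]
  -- Both maps of the realization of `e^*θ` vanish, so its middle term is zero.
  obtain ⟨χ, hχ⟩ := hW.exists_fac_left (𝟙 W) (by rw [hy, comp_zero])
  have hW0 : IsZero W := by
    rw [IsZero.iff_id_eq_zero, ← hχ, hk, comp_zero]
  exact ⟨D, 0, _, hW.of_iso_mid hW0.isoZero ((isZero_zero C).eq_of_tgt _ _)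
    (by rw [hy, comp_zero])⟩

/-! ### Rotation of triangles along `K ⟶ 0 ⟶ FK`. -/

namespace ShiftChoice

variable (F : T.ShiftChoice) (K : T.L.FullSubcategory)

/-- The homotopy pushout of `K ⟶ 0` along `i` realizes `i_*δ_K` and also exhibits a cone of `i`.
Uniqueness of the cone identifies it with `A`, and injectivity of `φ ↦ φ^*δ_K` identifies the map to
`FK` with `p`. The sign comes from the `-s` in the pushout triangle. -/
lemma isTriangle_rotate {X A : C} {i : K.obj ⟶ X} {a : X ⟶ A} {p : A ⟶ F.obj K}
    (h : T.IsTriangle i a (pull T.E p (F.ext K))) :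
    T.IsTriangle a p (-push T.E i (F.ext K)) := by
  obtain ⟨P, d, q, b, h₁, -, -, h₂⟩ := (F.isTriangle K).exists_homotopy_pushout i
  have h₃ : T.IsTriangle i (-d) (pull T.E q (F.ext K)) :=
    h₂.of_iso_mid ⟨biprod.snd, biprod.inr, by ext; simp, by simp⟩ (by simp)
      (by ext; simp)
  obtain ⟨c, hc, e⟩ := h.exists_iso_right h₃
  have hp : c.hom ≫ q = p := (F.pullHom_bijective A K).1 ((T.pull_comp _ _ _).trans e)
  refine h₁.neg_left.of_iso (Iso.refl _) c.symm (Iso.refl _) ?_ ?_ ?_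
  · simp [← hc]
  · simp [← hp]
  · exact (T.push_id _).trans (T.pull_id _).symm

/-- Dual argument: the homotopy pullback of `0 ⟶ FK` along `c` exhibits a cocone of `c`, which must
be `b` up to isomorphism. -/
lemma isTriangle_rotate_inv {Y P : C} {m : K.obj ⟶ Y} {b : Y ⟶ P} {c : P ⟶ F.obj K}
    (h : T.IsTriangle b c (-push T.E m (F.ext K))) :
    T.IsTriangle m b (pull T.E c (F.ext K)) := by
  obtain ⟨W, s, t, k, h₁, -, -, h₂⟩ := (F.isTriangle K).exists_homotopy_pullback c
  have h₃ : T.IsTriangle (-t) c (push T.E s (F.ext K)) :=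
    h₂.of_iso_mid ⟨biprod.fst, biprod.inl, by ext; simp, by simp⟩ (by simp)
      (by ext; simp)
  obtain ⟨x, hx, e⟩ := h₃.exists_iso_left h
  have hm : s ≫ x.hom = -m := by
    refine (F.pushHom_bijective K Y).1 ((T.push_comp _ _ _).trans (e.trans ?_))
    exact (T.push_neg _ _).symm
  refine h₁.neg_both.of_iso (Iso.refl _) x (Iso.refl _) ?_ ?_ ?_
  · simp [hm]
  · simp [hx]
  · exact (T.push_id _).trans (T.pull_id _).symm

end ShiftChoice

/-! ### Homotopy squares with both pairs of parallel sides completed to triangles. -/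

lemma IsInflation.comp {X Y Z : C} {a : X ⟶ Y} {b : Y ⟶ Z} (ha : T.IsInflation a)
    (hb : T.IsInflation b) : T.IsInflation (a ≫ b) := by
  obtain ⟨_, _, _, ha⟩ := ha
  obtain ⟨_, _, _, hb⟩ := hb
  obtain ⟨P, m, k, -, -, θ, -, hθ, -, hm, -⟩ := T.et4 _ _ _ _ _ _ ha hb
  exact ⟨P, k, θ, hm ▸ hθ⟩

namespace IsTriangle

/-- The homotopy pushout of two inflations, with a prescribed realization of one of its rows. -/
lemma exists_pushout_of_inflations {X Y Z L D W : C} {f : X ⟶ Y} {g : Y ⟶ Z} {δ : Ext T.E Z X}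
    {a : X ⟶ L} {p : L ⟶ D} {ι : Ext T.E D X} {s : L ⟶ W} {t : W ⟶ Z}
    (h : T.IsTriangle f g δ) (h' : T.IsTriangle a p ι) (hst : T.IsTriangle s t (push T.E a δ)) :
    ∃ (b : Y ⟶ W) (c : W ⟶ D),
      f ≫ b = a ≫ s ∧ b ≫ t = g ∧ s ≫ c = p ∧
      T.IsTriangle (biprod.lift f a) (biprod.desc b (-s)) (pull T.E t δ) ∧
      T.IsTriangle b c (push T.E f ι) ∧ pull T.E t δ = -pull T.E c ι := by
  obtain ⟨W₁, s₁, t₁, b₁, hst₁, hfb₁, hbt₁, hW₁⟩ := h.exists_homotopy_pushout a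
  obtain ⟨W₂, s₂, t₂, b₂, hst₂, hfb₂, hbt₂, hW₂⟩ := h'.exists_homotopy_pushout f
  obtain ⟨φ, hφs, hφt⟩ := hst₁.exists_iso hst
  -- Pushing `f` along `a` and `a` along `f` gives, up to swapping the summands, two cones of the
  -- same inflation `(f, a)`.
  obtain ⟨χ, hχ, e⟩ := hW₁.exists_iso_right
    (hW₂.of_iso_mid (biprod.braiding L Y) (f' := biprod.lift f a)
      (g' := biprod.desc (-s₂) b₂) (by ext <;> simp) (by ext <;> simp))
  have hχb : b₁ ≫ χ.hom = -s₂ := by simpa using biprod.inl ≫= hχ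
  have hχs : s₁ ≫ χ.hom = -b₂ := by
    have := biprod.inr ≫= hχ
    simp only [biprod.inr_desc_assoc, Preadditive.neg_comp, biprod.inr_desc] at this
    rw [← this, neg_neg]
  have hφt' : φ.inv ≫ t₁ = t := by rw [← hφt, φ.inv_hom_id_assoc]
  have hφs' : s ≫ φ.inv = s₁ := by rw [← hφs, Category.assoc, φ.hom_inv_id, Category.comp_id]
  refine ⟨b₁ ≫ φ.hom, -(φ.inv ≫ χ.hom ≫ t₂), ?_, ?_, ?_, ?_, ?_, ?_⟩
  · rw [← Category.assoc, hfb₁, Category.assoc, hφs]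
  · rw [Category.assoc, hφt, hbt₁]
  · rw [Preadditive.comp_neg, reassoc_of% hφs', reassoc_of% hχs]
    simp [hbt₂]
  · refine hW₁.of_iso (Iso.refl _) (Iso.refl _) φ (by simp) (by ext <;> simp [hφs]) ?_
    rw [← T.pull_comp, hφt]
    exact T.push_id _
  · refine hst₂.neg_both.of_iso_mid (χ.symm ≪≫ φ) ?_ (by simp)
    simp [← hχb]
  · rw [T.pull_neg, neg_neg, T.pull_comp, T.pull_comp, e, ← T.pull_comp, hφt']

/-- The homotopy pullback of two deflations. -/
lemma exists_pullback_of_deflations {L M N K Z : C} {u : L ⟶ M} {v : M ⟶ N} {ε : Ext T.E N L}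
    {i : K ⟶ Z} {c : Z ⟶ N} {κ : Ext T.E N K}
    (h : T.IsTriangle u v ε) (h' : T.IsTriangle i c κ) :
    ∃ (W : C) (s : L ⟶ W) (t : W ⟶ Z) (b : W ⟶ M) (j : K ⟶ W),
      T.IsTriangle s t (pull T.E c ε) ∧ s ≫ b = u ∧ b ≫ v = t ≫ c ∧ j ≫ t = i ∧
      T.IsTriangle (biprod.lift (-t) b) (biprod.desc c v) (push T.E s ε) ∧
      T.IsTriangle j b (pull T.E v κ) ∧ push T.E s ε = -push T.E j κ := by
  obtain ⟨W, s, t, b, hst, hsb, hbt, hW⟩ := h.exists_homotopy_pullback c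
  obtain ⟨W₂, s₂, t₂, b₂, hst₂, hsb₂, hbt₂, hW₂⟩ := h'.exists_homotopy_pullback v
  obtain ⟨χ, hχ, e⟩ := hW.exists_iso_left
    (hW₂.of_iso_mid (biprod.braiding M Z) (f' := biprod.lift b₂ (-t₂))
      (g' := biprod.desc c v) (by ext <;> simp) (by ext <;> simp))
  have hχt : χ.hom ≫ b₂ = -t := by simpa using hχ =≫ biprod.fst
  have hχb : χ.hom ≫ t₂ = -b := by
    have := hχ =≫ biprod.snd
    simp only [Category.assoc, biprod.lift_snd, Preadditive.comp_neg] at this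
    rw [← this, neg_neg]
  have hb₂ : χ.inv ≫ t = -b₂ := by
    rw [← neg_neg t, ← hχt]; simp
  have ht₂ : χ.inv ≫ b = -t₂ := by
    rw [← neg_neg b, ← hχb]; simp
  refine ⟨W, s, t, b, -(s₂ ≫ χ.inv), hst, hsb, hbt, ?_, hW, ?_, ?_⟩
  · simp [hb₂, hsb₂]
  · exact hst₂.neg_both.of_iso_mid χ.symm (by simp) ht₂
  · rw [T.push_neg, neg_neg, T.push_comp, ← e, ← T.push_comp, χ.hom_inv_id, T.push_id]

end IsTriangle

/-! ### Cocones in `ℒ` and naturality with respect to `F`. -/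

namespace ShiftChoice

variable (F : T.ShiftChoice)

/-- A morphism which is both an inflation and a deflation has a cocone in `ℒ`. -/
lemma exists_cocone {X A : C} {a : X ⟶ A} (ha : T.IsInflation a) (ha' : T.IsDeflation a) :
    ∃ (K : T.L.FullSubcategory) (i : K.obj ⟶ X) (p : A ⟶ F.obj K),
      T.IsTriangle i a (pull T.E p (F.ext K)) := by
  obtain ⟨K, i, κ, h⟩ := ha'
  obtain ⟨p, hp⟩ := (F.pullHom_bijective A ⟨K, h.mem_L ha⟩).2 κ
  refine ⟨⟨K, h.mem_L ha⟩, i, p, ?_⟩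
  change pull T.E p _ = κ at hp
  rwa [hp]

/-- Both composites classify the same extension in `𝔼(A, K')`. -/
lemma comp_map_eq {A A' : C} {K K' : T.L.FullSubcategory} {k : K ⟶ K'} {a : A ⟶ A'}
    {p : A ⟶ F.obj K} {p' : A' ⟶ F.obj K'}
    (h : push T.E k.hom (pull T.E p (F.ext K)) = pull T.E a (pull T.E p' (F.ext K'))) :
    p ≫ F.map k = a ≫ p' := by
  refine (F.pullHom_bijective A K').1 ?_
  change pull T.E _ _ = pull T.E _ _
  rw [T.pull_comp, ← F.map_spec, ← T.push_pull, h, T.pull_comp]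

lemma push_ext_eq {A A' : C} {K K' : T.L.FullSubcategory} {k : K ⟶ K'} {a : A ⟶ A'}
    {i : K.obj ⟶ A} {i' : K'.obj ⟶ A'} (h : k.hom ≫ i' = i ≫ a) :
    push T.E a (-push T.E i (F.ext K)) = pull T.E (F.map k) (-push T.E i' (F.ext K')) := by
  rw [map_neg, map_neg, ← T.push_comp, ← h, T.push_comp, F.map_spec, T.push_pull]

end ShiftChoice

end ExtriangulatedCategory

end Extri

/-! ### The diagram. -/

theorem theorem4p11 {C : Type u} [Category.{v} C] [Preadditive C] [HasZeroObject C]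
    [HasBinaryBiproducts C] (T : Extri.ExtriangulatedCategory.{w} C) (F : T.ShiftChoice)
    {X Y Z L M N : C}
    (f : X ⟶ Y) (g : Y ⟶ Z) (δ : Extri.Ext T.E Z X)
    (u : L ⟶ M) (v : M ⟶ N) (ε : Extri.Ext T.E N L)
    (hδ : T.IsTriangle f g δ) (hε : T.IsTriangle u v ε)
    (α : X ⟶ L) (γ : Z ⟶ N)
    (hαγ : Extri.push T.E α δ = Extri.pull T.E γ ε)
    (hα_infl : T.IsInflation α) (hα_defl : T.IsDeflation α)
    (hγ_infl : T.IsInflation γ) (hγ_defl : T.IsDeflation γ) :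
    ∃ β : Y ⟶ M,
      T.IsInflation β ∧ T.IsDeflation β ∧
      T.IsHomotopic f g δ u v ε α β γ ∧
      ∃ (Kα Kβ Kγ : T.L.FullSubcategory)
        (f' : Kα ⟶ Kβ) (g' : Kβ ⟶ Kγ)
        (iα : Kα.obj ⟶ X) (iβ : Kβ.obj ⟶ Y) (iγ : Kγ.obj ⟶ Z)
        (pα : L ⟶ (F.functor.obj Kα).obj) (pβ : M ⟶ (F.functor.obj Kβ).obj)
        (pγ : N ⟶ (F.functor.obj Kγ).obj)
        (z : Kγ.obj ⟶ (F.functor.obj Kα).obj)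
        (u' : (F.functor.obj Kα).obj ⟶ (F.functor.obj Kβ).obj)
        (v' : (F.functor.obj Kβ).obj ⟶ (F.functor.obj Kγ).obj),
        u' = (F.functor.map f').hom ∧
        v' = (F.functor.map g').hom ∧
        -- the ten `𝔼`-triangles
        T.IsTriangle f'.hom g'.hom ((F.ell Kγ.obj Kα).symm z) ∧
        T.IsTriangle g'.hom z (-(F.ell (F.functor.obj Kα).obj Kβ).symm u') ∧
        T.IsTriangle z u' ((F.rho Kβ Kγ.obj).symm g'.hom) ∧
        T.IsTriangle u' v' (-(F.rho Kγ (F.functor.obj Kα).obj).symm z) ∧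
        T.IsTriangle iα α ((F.ell L Kα).symm pα) ∧
        T.IsTriangle iβ β ((F.ell M Kβ).symm pβ) ∧
        T.IsTriangle iγ γ ((F.ell N Kγ).symm pγ) ∧
        T.IsTriangle α pα (-(F.rho Kα X).symm iα) ∧
        T.IsTriangle β pβ (-(F.rho Kβ Y).symm iβ) ∧
        T.IsTriangle γ pγ (-(F.rho Kγ Z).symm iγ) ∧
        -- the morphisms of `𝔼`-triangles between the rows
        T.IsMorphism f'.hom g'.hom ((F.ell Kγ.obj Kα).symm z) f g δ iα iβ iγ ∧
        T.IsMorphism u v ε u' v' (-(F.rho Kγ (F.functor.obj Kα).obj).symm z) pα pβ pγ ∧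
        -- the morphisms of `𝔼`-triangles between the columns
        T.IsMorphism iα α ((F.ell L Kα).symm pα) iβ β ((F.ell M Kβ).symm pβ) f'.hom f u ∧
        T.IsMorphism α pα (-(F.rho Kα X).symm iα) β pβ (-(F.rho Kβ Y).symm iβ) f u u' ∧
        T.IsMorphism iβ β ((F.ell M Kβ).symm pβ) iγ γ ((F.ell N Kγ).symm pγ) g'.hom g v ∧
        T.IsMorphism β pβ (-(F.rho Kβ Y).symm iβ) γ pγ (-(F.rho Kγ Z).symm iγ) g v v' := by
  obtain ⟨Kα, iα, pα, tα⟩ := F.exists_cocone hα_infl hα_defl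
  obtain ⟨Kγ, iγ, pγ, tγ⟩ := F.exists_cocone hγ_infl hγ_defl
  have rα := F.isTriangle_rotate Kα tα
  have rγ := F.isTriangle_rotate Kγ tγ
  obtain ⟨W, s, t, β₂, j, hst, hsβ₂, hβ₂v, hjt, hW₂, hjβ₂, hsε⟩ :=
    hε.exists_pullback_of_deflations tγ
  -- The pullback row realizes `γ^*ε = α_*δ`, so it can be prescribed as the pushout row and both
  -- squares share `W`.
  obtain ⟨β₁, c, hfβ₁, hβ₁t, hsc, hW₁, hβ₁c, htδ⟩ :=
    hδ.exists_pushout_of_inflations rα (hαγ ▸ hst)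
  rw [map_neg, neg_neg] at htδ
  rw [map_neg, ← T.push_comp] at hβ₁c
  have hθ := F.isTriangle_rotate_inv Kα hβ₁c
  obtain ⟨B, f', g', iβ, β, δ', ε', hrow, hcol, hf'iβ, hiββ₁, rfl, hδ', hε', hf'⟩ :=
    T.et4_op _ _ _ _ _ _ hθ hjβ₂
  have hβ_infl : T.IsInflation (β₁ ≫ β₂) := by
    -- The extension of `Kγ ⟶ W ⟶ M` is classified by `v ≫ pγ`, so rotation makes `β₂` an inflation.
    rw [← T.pull_comp] at hjβ₂
    exact .comp ⟨_, _, _, hβ₁c⟩ ⟨_, _, _, F.isTriangle_rotate Kγ hjβ₂⟩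
  have hB : T.L B := Extri.ExtriangulatedCategory.IsTriangle.mem_L hcol hβ_infl
  obtain ⟨Kβ, rfl⟩ : ∃ Kβ : T.L.FullSubcategory, Kβ.obj = B := ⟨⟨B, hB⟩, rfl⟩
  obtain ⟨pβ, rfl⟩ := (F.pullHom_bijective M Kβ).2 ε'
  obtain ⟨f', rfl⟩ : ∃ k : Kα ⟶ Kβ, k.hom = f' := ⟨ObjectProperty.homMk f', rfl⟩
  obtain ⟨g', rfl⟩ : ∃ k : Kβ ⟶ Kγ, k.hom = g' := ⟨ObjectProperty.homMk g', rfl⟩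
  change T.IsTriangle iβ (β₁ ≫ β₂) (Extri.pull T.E pβ (F.ext Kβ)) at hcol
  change Extri.push T.E g'.hom (Extri.pull T.E pβ (F.ext Kβ)) = _ at hε'
  change _ = Extri.pull T.E β₂ (Extri.pull T.E pβ (F.ext Kβ)) at hf'
  -- The row of cocones has extension `j^* c^* δ_Kα`, so the connecting morphism `z` is `j ≫ c`.
  rw [← T.pull_comp] at hδ'
  subst hδ'
  have rβ := F.isTriangle_rotate Kβ hcol
  -- the rotations of the row of cocones
  have r₂ : T.IsTriangle g'.hom (j ≫ c) (-Extri.pull T.E (F.map f') (F.ext Kβ)) := by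
    rw [← F.map_spec]; exact F.isTriangle_rotate Kα hrow
  have r₃ : T.IsTriangle (j ≫ c) (F.map f') (Extri.push T.E g'.hom (F.ext Kβ)) := by
    -- The sign is absorbed into the classifying map `-Ff'`, and is removed after rotation by
    -- negating the deflation.
    rw [← T.pull_neg] at r₂
    simpa using (F.isTriangle_rotate Kβ r₂).neg_right
  have r₄ : T.IsTriangle (F.map f') (F.map g') (-Extri.push T.E (j ≫ c) (F.ext Kγ)) := by
    rw [F.map_spec] at r₃; exact F.isTriangle_rotate Kγ r₃
  -- the squares of the diagram and the compatibility with the extensions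
  have hfβ : f ≫ β₁ ≫ β₂ = α ≫ u := by rw [reassoc_of% hfβ₁, hsβ₂]
  have hβv : (β₁ ≫ β₂) ≫ v = g ≫ γ := by rw [Category.assoc, hβ₂v, reassoc_of% hβ₁t]
  have hig : iβ ≫ g = g'.hom ≫ iγ := by rw [← hβ₁t, reassoc_of% hiββ₁, hjt]
  have ef' : Extri.push T.E f'.hom (Extri.pull T.E pα (F.ext Kα)) =
      Extri.pull T.E u (Extri.pull T.E pβ (F.ext Kβ)) := by
    rw [← hsc, T.pull_comp, T.push_pull, hf', ← T.pull_comp, hsβ₂]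
  have hup : pα ≫ F.map f' = u ≫ pβ := F.comp_map_eq ef'
  have hvp : pβ ≫ F.map g' = v ≫ pγ := F.comp_map_eq hε'
  have eδ : Extri.push T.E iα (Extri.pull T.E (j ≫ c) (F.ext Kα)) = Extri.pull T.E iγ δ := by
    rw [← hjt, T.pull_comp, T.pull_comp, T.push_pull, T.push_pull, htδ]
  have eε : Extri.push T.E pα ε = Extri.pull T.E pγ (-Extri.push T.E (j ≫ c) (F.ext Kγ)) := by
    rw [← hsc, T.push_comp, hsε, map_neg, map_neg, ← T.push_comp, T.push_pull]
  -- The inverses of `ell` and `rho` unfold to `φ^*δ_K` and `ψ_*δ_K`, so the triangles above match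
  -- the required ones by definition.
  refine ⟨β₁ ≫ β₂, hβ_infl, ⟨_, _, _, hcol⟩,
    ⟨⟨hδ, hε, hfβ, hβv.symm, hαγ⟩, W, s, t, _, β₁, β₂,
      ⟨hδ, hst, hfβ₁, by simp [hβ₁t], hαγ.trans (T.pull_id _).symm⟩,
      ⟨hst, hε, by simp [hsβ₂], hβ₂v.symm, T.push_id _⟩, rfl, hW₁, hW₂⟩,
    Kα, Kβ, Kγ, f', g', iα, iβ, iγ, pα, pβ, pγ, j ≫ c, F.map f', F.map g', rfl, rfl,
    hrow, r₂, r₃, r₄, tα, hcol, tγ, rα, rβ, rγ,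
    ⟨hrow, hδ, hf'iβ, hig.symm, eδ⟩, ⟨hε, r₄, hup.symm, hvp.symm, eε⟩,
    ⟨tα, hcol, hf'iβ.symm, hfβ.symm, ef'⟩,
    ⟨rα, rβ, hfβ.symm, hup, F.push_ext_eq hf'iβ⟩,
    ⟨hcol, tγ, hig, hβv, hε'⟩,
    ⟨rβ, rγ, hβv, hvp, F.push_ext_eq hig.symm⟩⟩
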